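/- For a unital $C^*$-algebra $B$ let $U_0(B)$ be the connected component of $1$ in its unitary group, and for $u\in U_0(B)$ let $$cel(u)=\inf\Big\{\sum_{j=1}^{r}\|h_j\| : u=\exp(ih_1)\exp(ih_2)\cdots\exp(ih_r),\ h_j=h_j^*\in B\Big\}$$ be the $C^*$ exponential length of $u$. Let $x_1,x_2,\dots$ be a sequence of distinct points that is dense in $[0,1]$, and let $(k_n)_{n\ge 2}$ be a sequence of non-negative integers with $$\prod_{n=2}^{\infty}\frac{10^{k_n}-1}{10^{k_n}}>\frac{11}{12}.$$ Put $A_1=M_{10}(C[0,1])$ and $A_{n}=M_{10^{k_{n}}}(A_{n-1})$ for $n\ge 2$, and regard the elements of $A_n$ as matrix-valued functions on $[0,1]$. For $n\ge 1$ let $\varphi_{n,n+1}:A_n\to A_{n+1}$ be $$\varphi_{n,n+1}(f)=\mathrm{diag}\big(f,\dots,f,f(x_n)\big),$$ a block diagonal matrix of size $10^{k_{n+1}}\times 10^{k_{n+1}}$ over $A_n$ with $10^{k_{n+1}}-1$ entries $f$ and a last entry equal to the constant function $f(x_n)$. Let $\varphi_{1,n}=\varphi_{n-1,n}\circ\cdots\circ\varphi_{1,2}:A_1\to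 A_n$ (with $\varphi_{1,1}=\mathrm{id}$). Let $\varepsilon\in(0,\tfrac1{100})$ and let $u_\varepsilon\in A_1$ be the unitary $$u_\varepsilon(t)=\mathrm{diag}\Big(e^{-2\pi i t(\frac{9}{10}-\varepsilon)},\ \underbrace{e^{2\pi i t(\frac{1}{10}-\varepsilon)},\dots,e^{2\pi i t(\frac{1}{10}-\varepsilon)}}_{9}\Big),\qquad t\in[0,1].$$ Then for every $n\ge 1$ the unitary $\varphi_{1,n}(u_\varepsilon)$ lies in $U_0(A_n)$ and $$cel(\varphi_{1,n}(u_\varepsilon))\ \ge\ 2\pi\Big(\frac{9}{10}-\varepsilon\Big)-5\varepsilon .$$ -/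

import Mathlib

open scoped unitInterval

noncomputable section

namespace Goodearl

/-! ### Exponential length -/

/-- The C⋆ exponential length of a unitary `u`: the infimum of `‖h₁‖ + ⋯ + ‖h_r‖` over all
factorizations `u = exp(i h₁) ⋯ exp(i h_r)` with self-adjoint `h₁, …, h_r`.  Such factorizations
exist exactly when `u` lies in the connected component of `1` in the unitary group. -/
def cel {A : Type*} [CStarAlgebra A] (u : unitary A) : ℝ :=
  sInf {r : ℝ | ∃ l : List (selfAdjoint A),
    u = (l.map selfAdjoint.expUnitary).prod ∧ r = (l.map fun h => ‖h‖).sum}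

/-! ### Matrix algebras over a C⋆-algebra -/

/-- The C⋆-algebra `M_m(B)` for a unital C⋆-algebra `B`.  Mathlib's construction asks for the
order of `B`, which is its usual (spectral) order. -/
abbrev matrixCStarAlgebra (m : ℕ) (B : Type) [CStarAlgebra B] :
    CStarAlgebra (CStarMatrix (Fin m) (Fin m) B) :=
  letI : PartialOrder B := CStarAlgebra.spectralOrder B
  letI : StarOrderedRing B := CStarAlgebra.spectralOrderedRing B
  inferInstance

/-- A unital ⋆-homomorphism `B → C` applied to each entry of an `m × m` matrix. -/
def entrywise (m : ℕ) {B C : Type} [CStarAlgebra B] [CStarAlgebra C] (e : B →⋆ₐ[ℂ] C) :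
    CStarMatrix (Fin m) (Fin m) B →⋆ₐ[ℂ] CStarMatrix (Fin m) (Fin m) C where
  toFun M := M.map e
  map_one' := by
    ext i j
    by_cases h : i = j <;> simp [CStarMatrix.one_apply, h]
  map_mul' M N := by
    ext i j
    simp [CStarMatrix.mul_apply]
  map_zero' := by
    ext i j
    simp
  map_add' M N := by
    ext i j
    simp
  commutes' c := by
    ext i j
    by_cases h : i = j
    · simpa [CStarMatrix.algebraMap_apply, h] using AlgHomClass.commutes e c
    · simp [CStarMatrix.algebraMap_apply, h]
  map_star' M := by
    ext i j
    simpa [CStarMatrix.star_apply] using map_star e (M j i)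

/-- The unital ⋆-homomorphism `f ↦ diag(f, …, f, e(f))` from `B` to `M_m(B)`, with `m - 1` copies
of `f`, attached to a unital ⋆-homomorphism `e : B → B`. -/
def diagHom (m : ℕ) {B : Type} [CStarAlgebra B] (e : B →⋆ₐ[ℂ] B) :
    B →⋆ₐ[ℂ] CStarMatrix (Fin m) (Fin m) B where
  toFun f := CStarMatrix.ofMatrix
    (Matrix.diagonal fun i : Fin m => if (i : ℕ) + 1 = m then e f else f)
  map_one' := by
    ext i j
    by_cases h : i = j <;> simp [CStarMatrix.one_apply, h]
  map_mul' f g := by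
    refine Eq.trans ?_ (congrArg CStarMatrix.ofMatrix (Matrix.diagonal_mul_diagonal _ _).symm)
    congr 2
    funext i
    split_ifs <;> simp
  map_zero' := by
    ext i j
    simp
  map_add' f g := by
    ext i j
    simp only [CStarMatrix.add_apply, CStarMatrix.ofMatrix_apply, Matrix.diagonal_apply, map_add]
    split_ifs <;> simp
  commutes' c := by
    ext i j
    by_cases h : i = j
    · subst h
      simpa [CStarMatrix.algebraMap_apply] using fun _ => AlgHomClass.commutes e c
    · simp [CStarMatrix.algebraMap_apply, h]
  map_star' f := by
    refine Eq.trans ?_ (congrArg CStarMatrix.ofMatrix (Matrix.diagonal_conjTranspose _).symm)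
    congr 2
    funext i
    rw [Pi.star_apply]
    split_ifs
    · exact map_star e f
    · rfl

/-! ### The inductive system

Indices are shifted to start at `0`: `Alg k n` is the algebra `A_{n+1}`, and `k n` and `x n` stand
for `k_{n+2}` and `x_{n+1}`. -/

/-- `A₁ = M₁₀(C[0,1])` and `A_{n+2} = M_{10^{k_{n+2}}}(A_{n+1})`. -/
def Alg (k : ℕ → ℕ) : ℕ → Type
  | 0 => CStarMatrix (Fin 10) (Fin 10) C(I, ℂ)
  | n + 1 => CStarMatrix (Fin (10 ^ k n)) (Fin (10 ^ k n)) (Alg k n)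

instance instCStarAlgebraAlg (k : ℕ → ℕ) : (n : ℕ) → CStarAlgebra (Alg k n)
  | 0 => matrixCStarAlgebra 10 C(I, ℂ)
  | n + 1 =>
    letI := instCStarAlgebraAlg k n
    matrixCStarAlgebra (10 ^ k n) (Alg k n)

/-- The map of `C[0,1]` that sends `f` to the constant function with value `f(x)`. -/
def constAt (x : I) : C(I, ℂ) →⋆ₐ[ℂ] C(I, ℂ) where
  toFun f := ContinuousMap.const I (f x)
  map_one' := rfl
  map_mul' _ _ := rfl
  map_zero' := rfl
  map_add' _ _ := rfl
  commutes' _ := rfl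
  map_star' _ := rfl

/-- Elements of `A_{n+1}` are (iterated) matrices of functions on `[0,1]`.  `evalAt k x n` sends
`f ∈ A_{n+1}` to the constant matrix function `f(x)`, again an element of `A_{n+1}`. -/
def evalAt (k : ℕ → ℕ) (x : I) : (n : ℕ) → (Alg k n →⋆ₐ[ℂ] Alg k n)
  | 0 => entrywise 10 (constAt x)
  | n + 1 => entrywise (10 ^ k n) (evalAt k x n)

/-- The connecting map `φ_{n+1,n+2} : A_{n+1} → A_{n+2}`, `f ↦ diag(f, …, f, f(x_{n+1}))`, of size
`10^{k_{n+2}}`. -/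
def connect (k : ℕ → ℕ) (x : ℕ → I) (n : ℕ) : Alg k n →⋆ₐ[ℂ] Alg k (n + 1) :=
  diagHom (10 ^ k n) (evalAt k (x n) n)

/-- The composite `φ_{1,n+1} : A₁ → A_{n+1}` of the connecting maps. -/
def phi (k : ℕ → ℕ) (x : ℕ → I) : (n : ℕ) → (Alg k 0 →⋆ₐ[ℂ] Alg k n)
  | 0 => StarAlgHom.id ℂ (Alg k 0)
  | n + 1 => (connect k x n).comp (phi k x n)

/-! ### The unitary `u_ε` -/

/-- The function `t ↦ exp(2πi t c)` in `C[0,1]`. -/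
def expFun (c : ℝ) : C(I, ℂ) where
  toFun t := Complex.exp (2 * Real.pi * Complex.I * (t : ℝ) * c)
  continuous_toFun := by fun_prop

/-- The matrix function with `exp(-2πit(9/10-ε))` in the first diagonal position and
`exp(2πit(1/10-ε))` in the nine others. -/
def uMat (k : ℕ → ℕ) (ε : ℝ) : Alg k 0 :=
  CStarMatrix.ofMatrix (Matrix.diagonal fun i : Fin 10 =>
    if i = 0 then expFun (-(9 / 10 - ε)) else expFun (1 / 10 - ε))

lemma star_expFun_mul (c : ℝ) : star (expFun c) * expFun c = 1 := by
  ext t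
  simp only [expFun, ContinuousMap.mul_apply, ContinuousMap.star_apply, ContinuousMap.coe_mk,
    ContinuousMap.one_apply, Complex.star_def, ← Complex.exp_conj, ← Complex.exp_add]
  simp [Complex.conj_ofNat]

lemma uMat_mem (k : ℕ → ℕ) (ε : ℝ) : uMat k ε ∈ unitary (Alg k 0) := by
  have h : ∀ i : Fin 10, star (if i = 0 then expFun (-(9 / 10 - ε)) else expFun (1 / 10 - ε)) *
      (if i = 0 then expFun (-(9 / 10 - ε)) else expFun (1 / 10 - ε)) = 1 := by
    intro i
    split_ifs <;> exact star_expFun_mul _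
  have hs : star (uMat k ε) = CStarMatrix.ofMatrix (Matrix.diagonal fun i : Fin 10 =>
      star (if i = 0 then expFun (-(9 / 10 - ε)) else expFun (1 / 10 - ε))) :=
    congrArg CStarMatrix.ofMatrix (Matrix.diagonal_conjTranspose fun i : Fin 10 =>
      if i = 0 then expFun (-(9 / 10 - ε)) else expFun (1 / 10 - ε))
  rw [Unitary.mem_iff, hs]
  constructor
  · refine (congrArg CStarMatrix.ofMatrix (Matrix.diagonal_mul_diagonal _ _)).trans ?_
    simp only [h]
    exact congrArg CStarMatrix.ofMatrix Matrix.diagonal_one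
  · refine (congrArg CStarMatrix.ofMatrix (Matrix.diagonal_mul_diagonal _ _)).trans ?_
    simp only [mul_comm _ (star _), h]
    exact congrArg CStarMatrix.ofMatrix Matrix.diagonal_one

/-- `u_ε` as a unitary of `A₁`. -/
def uEps (k : ℕ → ℕ) (ε : ℝ) : unitary (Alg k 0) := ⟨uMat k ε, uMat_mem k ε⟩

/-- `φ_{1,n+1}(u_ε)` as a unitary of `A_{n+1}`. -/
def phiU (k : ℕ → ℕ) (x : ℕ → I) (n : ℕ) (ε : ℝ) : unitary (Alg k n) :=
  ⟨phi k x n (uEps k ε), Unitary.map_mem (phi k x n) (uEps k ε).2⟩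

end Goodearl

end

open scoped unitInterval

namespace Goodearl

open scoped Matrix.Norms.L2Operator
open Matrix NormedSpace

/-! ### Exponentials of Hermitian matrices in an eigenbasis. -/

section Hermitian

variable {ι : Type*} [Fintype ι] [DecidableEq ι]

/-! Suppose `phiU` is a product of exponentials of total length `ℓ < 2π(9/10 - ε)`. Evaluation at `t
∈ [0,1]` makes it a diagonal matrix of complex exponentials; let `T(t)` be the sum of the traces of
the exponents at `t`. Determinants fix `T(t)` modulo `2π`, so by continuity `T(1) - T(0)` is the
total change of the diagonal arguments (`traceSum_one_sub_zero`).

The values of `T` at the ends are controlled by `ℓ`: `T(0)` is at most the sum of the arguments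
chosen in `(ℓ - 2π, ℓ]` (`sum_re_trace_le`), and `T(1)` is at least the sum of those chosen in `[-ℓ,
2π - ℓ)` (`le_sum_re_trace`). Both rest on a Weyl type inequality for products of unitaries,
`eigenvalues_sub_le`.

Comparing the two, each clockwise entry contributes `-1` turn because its endpoint lies below `-ℓ`,
each counterclockwise entry contributes `0`, and each constant entry at most `1`
(`slope_add_toIocMod_sub_toIcoMod_le`). The sum would have to be nonnegative, but the hypothesis on
the product leaves so few constant entries that the total weight is negative (`sum_weight_neg`).
This gives the bound without the term `-5ε`. -/

lemma exp_I_smul_eq {A : Matrix ι ι ℂ} (hA : A.IsHermitian) :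
    exp (Complex.I • A) = (hA.eigenvectorUnitary : Matrix ι ι ℂ) *
      diagonal (fun j => Complex.exp (Complex.I * hA.eigenvalues j)) *
      star (hA.eigenvectorUnitary : Matrix ι ι ℂ) := by
  have hU : (hA.eigenvectorUnitary : Matrix ι ι ℂ)⁻¹ =
      star (hA.eigenvectorUnitary : Matrix ι ι ℂ) :=
    Matrix.inv_eq_left_inv (Unitary.coe_star_mul_self hA.eigenvectorUnitary)
  have h1 : Complex.I • A = (hA.eigenvectorUnitary : Matrix ι ι ℂ) *
      diagonal (fun j => Complex.I * hA.eigenvalues j) *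
      (hA.eigenvectorUnitary : Matrix ι ι ℂ)⁻¹ := by
    conv_lhs => rw [hA.spectral_theorem, Unitary.conjStarAlgAut_apply]
    rw [hU, ← Matrix.smul_mul, ← Matrix.mul_smul, ← Matrix.diagonal_smul]
    rfl
  rw [h1, Matrix.exp_conj _ _ (Unitary.isUnit_coe (U := hA.eigenvectorUnitary)),
    Matrix.exp_diagonal, hU]
  congr 3
  funext j
  rw [Pi.coe_exp, Complex.exp_eq_exp_ℂ]

lemma det_exp_I_smul {A : Matrix ι ι ℂ} (hA : A.IsHermitian) :
    (exp (Complex.I • A)).det = Complex.exp (Complex.I * A.trace) := by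
  rw [exp_I_smul_eq hA, Matrix.det_mul_right_comm, Unitary.mul_star_self_of_mem
    hA.eigenvectorUnitary.2, one_mul, det_diagonal, ← Complex.exp_sum, ← Finset.mul_sum,
    hA.trace_eq_sum_eigenvalues]
  rfl

lemma toEuclideanCLM_exp_apply_eigenvector {A : Matrix ι ι ℂ} (hA : A.IsHermitian) (j : ι) :
    toEuclideanCLM (𝕜 := ℂ) (exp (Complex.I • A)) (hA.eigenvectorBasis j) =
      Complex.exp (Complex.I * hA.eigenvalues j) • hA.eigenvectorBasis j := by
  have : exp (Complex.I • A) *ᵥ (hA.eigenvectorBasis j).ofLp =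
      Complex.exp (Complex.I * hA.eigenvalues j) • (hA.eigenvectorBasis j).ofLp := by
    rw [exp_I_smul_eq hA, ← mulVec_mulVec, hA.star_eigenvectorUnitary_mulVec, ← mulVec_mulVec,
      diagonal_mulVec_single, mul_one, ← hA.eigenvectorUnitary_mulVec, ← mulVec_smul]
    congr 1
    rw [← Pi.single_smul, smul_eq_mul, mul_one]
  ext i
  exact congrFun this i

lemma inner_eigenvector_exp_apply {A : Matrix ι ι ℂ} (hA : A.IsHermitian)
    (x : EuclideanSpace ℂ ι) (k : ι) :
    inner ℂ (hA.eigenvectorBasis k) (toEuclideanCLM (𝕜 := ℂ) (exp (Complex.I • A)) x) =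
      Complex.exp (Complex.I * hA.eigenvalues k) * inner ℂ (hA.eigenvectorBasis k) x := by
  conv_lhs => rw [← hA.eigenvectorBasis.sum_repr' x]
  simp only [map_sum, map_smul, toEuclideanCLM_exp_apply_eigenvector, inner_sum, inner_smul_right,
    hA.eigenvectorBasis.inner_eq_ite]
  simp [mul_comm]

/-- The real part of the rotated quadratic form of `exp (i A)`, in an eigenbasis of `A`. -/
lemma re_inner_exp_apply {A : Matrix ι ι ℂ} (hA : A.IsHermitian) (x : EuclideanSpace ℂ ι)
    (θ : ℝ) :
    (inner ℂ x (Complex.exp (-(Complex.I * θ)) •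
      toEuclideanCLM (𝕜 := ℂ) (exp (Complex.I • A)) x)).re =
      ∑ k, Real.cos (hA.eigenvalues k - θ) * ‖inner ℂ (hA.eigenvectorBasis k) x‖ ^ 2 := by
  rw [inner_smul_right, ← hA.eigenvectorBasis.sum_inner_mul_inner, Finset.mul_sum, Complex.re_sum]
  refine Finset.sum_congr rfl fun k _ => ?_
  rw [inner_eigenvector_exp_apply, ← inner_conj_symm x]
  have h : Complex.exp (-(Complex.I * θ)) * ((starRingEnd ℂ) (inner ℂ (hA.eigenvectorBasis k) x) *
      (Complex.exp (Complex.I * hA.eigenvalues k) * inner ℂ (hA.eigenvectorBasis k) x)) =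
      Complex.exp ((hA.eigenvalues k - θ : ℝ) * Complex.I) *
        ((‖inner ℂ (hA.eigenvectorBasis k) x‖ ^ 2 : ℝ) : ℂ) := by
    rw [Complex.ofReal_pow, ← Complex.conj_mul', show ((hA.eigenvalues k - θ : ℝ) : ℂ) * Complex.I =
      -(Complex.I * θ) + Complex.I * hA.eigenvalues k by push_cast; ring, Complex.exp_add]
    ring
  rw [h, Complex.re_mul_ofReal, Complex.exp_ofReal_mul_I_re]

lemma norm_sq_eq_sum_eigenvectorBasis {A : Matrix ι ι ℂ} (hA : A.IsHermitian)
    (x : EuclideanSpace ℂ ι) :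
    ∑ k, ‖inner ℂ (hA.eigenvectorBasis k) x‖ ^ 2 = ‖x‖ ^ 2 :=
  hA.eigenvectorBasis.sum_sq_norm_inner_right x

lemma exp_I_smul_mem_unitary {A : Matrix ι ι ℂ} (hA : A.IsHermitian) :
    exp (Complex.I • A) ∈ unitary (Matrix ι ι ℂ) :=
  (selfAdjoint.expUnitary ⟨A, hA⟩).2

lemma norm_toEuclideanCLM_apply {U : Matrix ι ι ℂ} (hU : U ∈ unitary (Matrix ι ι ℂ))
    (x : EuclideanSpace ℂ ι) : ‖toEuclideanCLM (𝕜 := ℂ) U x‖ = ‖x‖ := by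
  have h := Unitary.map_mem (toEuclideanCLM (n := ι) (𝕜 := ℂ)) hU
  exact ContinuousLinearMap.norm_map_of_mem_unitary h x

end Hermitian

/-! ### Eigenvalue perturbation under multiplication of unitaries. -/

section Perturbation

/-- The triangle inequality for angles between unit vectors, in terms of cosines. -/
lemma cos_add_le_re_inner {E : Type*} [NormedAddCommGroup E] [InnerProductSpace ℂ E]
    {x y z : E} (hx : ‖x‖ = 1) (hy : ‖y‖ = 1) (hz : ‖z‖ = 1) {a b : ℝ} (ha : 0 ≤ a) (hb : 0 ≤ b)
    (hab : a + b ≤ Real.pi) (hxy : Real.cos a ≤ (inner ℂ x y).re)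
    (hyz : Real.cos b ≤ (inner ℂ y z).re) :
    Real.cos (a + b) ≤ (inner ℂ x z).re := by
  let _ : InnerProductSpace ℝ E := InnerProductSpace.complexToReal
  have key : ∀ {v w : E} {c : ℝ}, ‖v‖ = 1 → ‖w‖ = 1 → 0 ≤ c → c ≤ Real.pi →
      Real.cos c ≤ (inner ℂ v w).re → InnerProductGeometry.angle v w ≤ c := by
    intro v w c hv hw hc hc' h
    have h2 : Real.cos (InnerProductGeometry.angle v w) = (inner ℂ v w).re := by
      rw [InnerProductGeometry.cos_angle, hv, hw]
      simp [real_inner_eq_re_inner ℂ]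
    rw [← h2] at h
    exact (Real.strictAntiOn_cos.le_iff_ge ⟨hc, hc'⟩
      ⟨InnerProductGeometry.angle_nonneg _ _, InnerProductGeometry.angle_le_pi _ _⟩).1 h
  have h1 := key hx hy ha (by linarith) hxy
  have h2 := key hy hz hb (by linarith) hyz
  have h3 := InnerProductGeometry.angle_le_angle_add_angle x y z
  have h4 : Real.cos (InnerProductGeometry.angle x z) = (inner ℂ x z).re := by
    rw [InnerProductGeometry.cos_angle, hx, hz]
    simp [real_inner_eq_re_inner ℂ]
  rw [← h4]
  exact Real.cos_le_cos_of_nonneg_of_le_pi (InnerProductGeometry.angle_nonneg _ _) hab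
    (by linarith)

/-- The angle `c - u` lies strictly between `-c` and `2π + c`, hence is farther from every multiple
of `2π` than `c` is. -/
lemma cos_sub_lt_cos {u c : ℝ} (hc : c ≤ 0) (h1 : -(2 * Real.pi) < u) (h2 : u < 2 * c) :
    Real.cos (u - c) < Real.cos c := by
  rw [← Real.cos_neg c, ← Real.cos_neg (u - c)]
  rcases le_total (-(u - c)) Real.pi with h | h
  · exact Real.cos_lt_cos_of_nonneg_of_le_pi (by linarith) h (by linarith)
  · rw [← Real.cos_two_pi_sub (-(u - c))]
    exact Real.cos_lt_cos_of_nonneg_of_le_pi (by linarith) (by linarith) (by linarith)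

variable {ι : Type*} [Fintype ι] [DecidableEq ι]

/-- The position of an index in the decreasing enumeration of the eigenvalues. -/
noncomputable def eigRank (i : ι) : Fin (Fintype.card ι) :=
  (Fintype.equivOfCardEq (Fintype.card_fin _)).symm i

lemma eigenvalues_le_of_eigRank_le {A : Matrix ι ι ℂ} (hA : A.IsHermitian) {i j : ι}
    (h : eigRank i ≤ eigRank j) : hA.eigenvalues j ≤ hA.eigenvalues i :=
  hA.eigenvalues₀_antitone h

/-- The two families together impose one linear condition for each index other than `j`, one fewer
than the dimension. This is the dimension count of the Courant–Fischer argument. -/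
lemma exists_unit_common_vector (v w : ι → EuclideanSpace ℂ ι) (j : ι) :
    ∃ x : EuclideanSpace ℂ ι, ‖x‖ = 1 ∧ (∀ k, eigRank j < eigRank k → inner ℂ (v k) x = 0) ∧
      ∀ k, eigRank k < eigRank j → inner ℂ (w k) x = 0 := by
  let F : EuclideanSpace ℂ ι →ₗ[ℂ] ({k : ι // k ≠ j} → ℂ) :=
    LinearMap.pi fun k => if eigRank j < eigRank k.1 then innerₛₗ ℂ (v k.1) else innerₛₗ ℂ (w k.1)
  have hF : LinearMap.ker F ≠ ⊥ := by
    apply F.ker_ne_bot_of_finrank_lt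
    rw [Module.finrank_fintype_fun_eq_card, finrank_euclideanSpace]
    exact Fintype.card_subtype_lt (x := j) (by simp)
  obtain ⟨y, hy, hy0⟩ := (Submodule.ne_bot_iff _).1 hF
  have hFy : ∀ k : {k : ι // k ≠ j}, F y k = 0 := fun k => by
    rw [LinearMap.mem_ker.1 hy]; rfl
  have hv : ∀ k, eigRank j < eigRank k → inner ℂ (v k) y = 0 := fun k hk => by
    have := hFy ⟨k, fun h => by simp [h] at hk⟩
    simpa [F, hk] using this
  have hw : ∀ k, eigRank k < eigRank j → inner ℂ (w k) y = 0 := fun k hk => by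
    have := hFy ⟨k, fun h => by simp [h] at hk⟩
    simpa [F, hk.not_gt] using this
  refine ⟨((‖y‖ : ℂ)⁻¹) • y, ?_, fun k hk => ?_, fun k hk => ?_⟩
  · rw [norm_smul, norm_inv, Complex.norm_real, norm_norm, inv_mul_cancel₀ (norm_ne_zero_iff.2 hy0)]
  · rw [inner_smul_right, hv k hk, mul_zero]
  · rw [inner_smul_right, hw k hk, mul_zero]

lemma abs_eigenvalues_le_norm {H : Matrix ι ι ℂ} (hH : H.IsHermitian) (i : ι) :
    |hH.eigenvalues i| ≤ ‖H‖ := by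
  have : Nonempty ι := ⟨i⟩
  have h := spectrum.norm_le_norm_of_mem (hH.eigenvalues_mem_spectrum_real i)
  simpa using h

/-- A weighted average of cosines is at least the cosine of the largest angle. -/
lemma cos_le_re_inner_exp_apply {A : Matrix ι ι ℂ} (hA : A.IsHermitian) {x : EuclideanSpace ℂ ι}
    (hx : ‖x‖ = 1) (θ : ℝ) {a : ℝ} (ha : a ≤ Real.pi)
    (h : ∀ k, inner ℂ (hA.eigenvectorBasis k) x ≠ 0 → |hA.eigenvalues k - θ| ≤ a) :
    Real.cos a ≤ (inner ℂ x (Complex.exp (-(Complex.I * θ)) •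
      toEuclideanCLM (𝕜 := ℂ) (exp (Complex.I • A)) x)).re := by
  rw [re_inner_exp_apply hA]
  calc Real.cos a = ∑ k, Real.cos a * ‖inner ℂ (hA.eigenvectorBasis k) x‖ ^ 2 := by
        rw [← Finset.mul_sum, norm_sq_eq_sum_eigenvectorBasis, hx]; simp
    _ ≤ _ := by
        refine Finset.sum_le_sum fun k _ => ?_
        by_cases hk : inner ℂ (hA.eigenvectorBasis k) x = 0
        · simp [hk]
        · rw [← Real.cos_abs (hA.eigenvalues k - θ)]
          exact mul_le_mul_of_nonneg_right
            (Real.cos_le_cos_of_nonneg_of_le_pi (abs_nonneg _) ha (h k hk)) (by positivity)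

lemma re_inner_exp_apply_lt {B : Matrix ι ι ℂ} (hB : B.IsHermitian) {x : EuclideanSpace ℂ ι}
    (hx : ‖x‖ = 1) {c : ℝ} (hc : c ≤ 0)
    (h : ∀ k, inner ℂ (hB.eigenvectorBasis k) x ≠ 0 →
      -(2 * Real.pi) < hB.eigenvalues k ∧ hB.eigenvalues k < 2 * c) :
    (inner ℂ x (Complex.exp (-(Complex.I * c)) •
      toEuclideanCLM (𝕜 := ℂ) (exp (Complex.I • B)) x)).re < Real.cos c := by
  rw [re_inner_exp_apply hB]
  have hs := norm_sq_eq_sum_eigenvectorBasis hB x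
  rw [hx] at hs
  calc _ < ∑ k, Real.cos c * ‖inner ℂ (hB.eigenvectorBasis k) x‖ ^ 2 := by
        apply Finset.sum_lt_sum
        · intro k _
          by_cases hk : inner ℂ (hB.eigenvectorBasis k) x = 0
          · simp [hk]
          · exact mul_le_mul_of_nonneg_right (cos_sub_lt_cos hc (h k hk).1 (h k hk).2).le
              (by positivity)
        · by_contra! hcon
          have : ∀ k, inner ℂ (hB.eigenvectorBasis k) x = 0 := by
            intro k
            by_contra hk
            refine absurd (hcon k (Finset.mem_univ k)) (not_le.2 ?_)
            exact mul_lt_mul_of_pos_right (cos_sub_lt_cos hc (h k hk).1 (h k hk).2) (by positivity)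
          simp [this] at hs
    _ = Real.cos c := by rw [← Finset.mul_sum, hs]; simp

/-- A Weyl type inequality: multiplying `exp (i A)` by `exp (i (H - b))`, where `‖H‖ ≤ b`, moves no
eigenvalue clockwise by more than `2 b`. -/
lemma eigenvalues_sub_le {A B H : Matrix ι ι ℂ} (hA : A.IsHermitian) (hB : B.IsHermitian)
    (hH : H.IsHermitian) (hAs : ∀ i, hA.eigenvalues i ≤ 0)
    (hBs : ∀ i, -(2 * Real.pi) < hB.eigenvalues i) {b : ℝ} (hb : ‖H‖ ≤ b)
    (h : exp (Complex.I • B) = Complex.exp (-(Complex.I * b)) •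
      (exp (Complex.I • A) * exp (Complex.I • H))) (j : ι) :
    hA.eigenvalues j - 2 * b ≤ hB.eigenvalues j := by
  by_contra! hlt
  obtain ⟨x, hx, hxA, hxB⟩ :=
    exists_unit_common_vector hA.eigenvectorBasis hB.eigenvectorBasis j
  have hb0 : 0 ≤ b := (norm_nonneg _).trans hb
  have hBj := hBs j
  have hAj := hAs j
  set α := hA.eigenvalues j with hα
  set W := toEuclideanCLM (𝕜 := ℂ) (exp (Complex.I • A)) with hW
  set V := toEuclideanCLM (𝕜 := ℂ) (exp (Complex.I • H)) with hV
  -- The idea: on `x` the spectrum of `A` lies in `[α, 0]`, an arc with centre `α / 2` and radius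
  -- `-α / 2`; multiplying by `exp (i H)` adds at most `b` to the angle. If the claim failed, the
  -- spectrum of `B` on `x` would lie in `(-2π, α - 2b)`, which forces a strictly larger angle.
  have hunit : ∀ θ : ℝ, ‖Complex.exp (-(Complex.I * θ))‖ = 1 := fun θ => by
    rw [show -(Complex.I * θ) = ((-θ : ℝ) : ℂ) * Complex.I by push_cast; ring]
    exact Complex.norm_exp_ofReal_mul_I _
  have hWn : ∀ y, ‖W y‖ = ‖y‖ := norm_toEuclideanCLM_apply (exp_I_smul_mem_unitary hA)
  have hVn : ∀ y, ‖V y‖ = ‖y‖ := norm_toEuclideanCLM_apply (exp_I_smul_mem_unitary hH)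
  have hWi : ∀ y z, inner ℂ (W y) (W z) = inner ℂ y z := fun y z =>
    (LinearIsometry.mk W.toLinearMap hWn).inner_map_map y z
  have hz : Complex.exp (-(Complex.I * (α / 2 - b : ℝ))) •
      toEuclideanCLM (𝕜 := ℂ) (exp (Complex.I • B)) x =
      Complex.exp (-(Complex.I * (α / 2 : ℝ))) • W (V x) := by
    rw [h, map_smul, map_mul, _root_.smul_apply, smul_smul, ← Complex.exp_add,
      ContinuousLinearMap.mul_def, ContinuousLinearMap.comp_apply]
    congr 2
    push_cast; ring
  have h1 : Real.cos (-(α / 2)) ≤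
      (inner ℂ x (Complex.exp (-(Complex.I * (α / 2 : ℝ))) • W x)).re := by
    refine cos_le_re_inner_exp_apply hA hx _ (by linarith) fun k hk => ?_
    have hk' : eigRank k ≤ eigRank j := not_lt.1 fun h' => hk (hxA k h')
    have := eigenvalues_le_of_eigRank_le hA hk'
    have := hAs k
    rw [abs_le]; constructor <;> linarith
  have h2 : Real.cos b ≤ (inner ℂ (Complex.exp (-(Complex.I * (α / 2 : ℝ))) • W x)
      (Complex.exp (-(Complex.I * (α / 2 : ℝ))) • W (V x))).re := by
    rw [inner_smul_left, inner_smul_right, ← mul_assoc, Complex.conj_mul', hunit, hWi]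
    have := cos_le_re_inner_exp_apply hH hx 0 (a := b) (by linarith) fun k _ => by
      rw [sub_zero]; exact (abs_eigenvalues_le_norm hH k).trans hb
    simpa using this
  -- The angles add up to at most `π` because `-2π < hB.eigenvalues j < α - 2 * b`.
  have h3 := cos_add_le_re_inner hx (by rw [norm_smul, hunit, hWn, hx, one_mul])
    (by rw [norm_smul, hunit, hWn, hVn, hx, one_mul]) (by linarith) hb0 (by linarith) h1 h2
  rw [← hz] at h3
  have h4 := re_inner_exp_apply_lt hB hx (c := α / 2 - b) (by linarith) fun k hk => by
    have hk' : eigRank j ≤ eigRank k := not_lt.1 fun h' => hk (hxB k h')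
    have := eigenvalues_le_of_eigRank_le hB hk'
    exact ⟨hBs k, by linarith⟩
  rw [show -(α / 2) + b = -(α / 2 - b) by ring, Real.cos_neg] at h3
  linarith

end Perturbation

/-! ### Traces of logarithms with spectrum in `(-2π, 0]`. -/

section Logarithm

variable {ι : Type*} [Fintype ι] [DecidableEq ι]

/-- A Hermitian matrix with spectrum in `(-2π, 0]`. -/
def IsBranch (A : Matrix ι ι ℂ) : Prop :=
  A.IsHermitian ∧ ∀ r ∈ spectrum ℝ A, r ∈ Set.Ioc (-(2 * Real.pi)) 0

lemma re_trace_eq_sum {A : Matrix ι ι ℂ} (hA : A.IsHermitian) :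
    A.trace.re = ∑ i, hA.eigenvalues i := by
  rw [hA.trace_eq_sum_eigenvalues, Complex.re_sum]
  rfl

lemma trace_eq_ofReal_re {A : Matrix ι ι ℂ} (hA : A.IsHermitian) :
    A.trace = (A.trace.re : ℂ) := by
  rw [re_trace_eq_sum hA, hA.trace_eq_sum_eigenvalues]
  push_cast; rfl

lemma re_trace_le_card_mul {H : Matrix ι ι ℂ} (hH : H.IsHermitian) {b : ℝ} (hb : ‖H‖ ≤ b) :
    H.trace.re ≤ Fintype.card ι * b := by
  rw [re_trace_eq_sum hH]
  calc ∑ i, hH.eigenvalues i ≤ ∑ _i : ι, b := Finset.sum_le_sum fun i _ =>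
        (le_abs_self _).trans ((abs_eigenvalues_le_norm hH i).trans hb)
    _ = _ := by simp

/-- By determinants the two sides differ by a multiple of `2π`. Summing `eigenvalues_sub_le` shows
that the right side falls short by at most `card ι * (2 * b) < 2π`, so the multiple is nonnegative.
-/
lemma re_trace_step {A B H : Matrix ι ι ℂ} (hA : IsBranch A) (hB : IsBranch B)
    (hH : H.IsHermitian) {b : ℝ} (hb : ‖H‖ ≤ b) (hsmall : Fintype.card ι * (2 * b) < 2 * Real.pi)
    (h : exp (Complex.I • B) = Complex.exp (-(Complex.I * b)) •
      (exp (Complex.I • A) * exp (Complex.I • H))) :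
    A.trace.re + H.trace.re - Fintype.card ι * b ≤ B.trace.re := by
  have hev := eigenvalues_sub_le hA.1 hB.1 hH
    (fun i => (hA.2 _ (hA.1.eigenvalues_mem_spectrum_real i)).2)
    (fun i => (hB.2 _ (hB.1.eigenvalues_mem_spectrum_real i)).1) hb h
  have hsum : A.trace.re - Fintype.card ι * (2 * b) ≤ B.trace.re := by
    rw [re_trace_eq_sum hA.1, re_trace_eq_sum hB.1]
    calc _ = ∑ i, (hA.1.eigenvalues i - 2 * b) := by simp
      _ ≤ _ := Finset.sum_le_sum fun i _ => hev i
  have htr := re_trace_le_card_mul hH hb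
  have hdet := congrArg Matrix.det h
  rw [det_smul, det_mul, det_exp_I_smul hA.1, det_exp_I_smul hB.1, det_exp_I_smul hH,
    ← Complex.exp_nat_mul, ← Complex.exp_add, ← Complex.exp_add, trace_eq_ofReal_re hA.1,
    trace_eq_ofReal_re hB.1, trace_eq_ofReal_re hH, Complex.exp_eq_exp_iff_exists_int] at hdet
  obtain ⟨n, hn⟩ := hdet
  have hD : B.trace.re - (A.trace.re + H.trace.re - Fintype.card ι * b) = n * (2 * Real.pi) := by
    have := congrArg Complex.im hn
    simp at this
    linarith
  have hn0 : (-1 : ℝ) < n := by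
    by_contra! hcon
    have : (n : ℝ) * (2 * Real.pi) ≤ -1 * (2 * Real.pi) :=
      mul_le_mul_of_nonneg_right hcon (by positivity)
    linarith
  have hn1 : (0 : ℝ) ≤ n := by
    have : (-1 : ℤ) < n := by exact_mod_cast hn0
    exact_mod_cast (show (0 : ℤ) ≤ n by omega)
  have : 0 ≤ (n : ℝ) * (2 * Real.pi) := by positivity
  linarith

lemma exp_toIocMod (a θ : ℝ) :
    Complex.exp (Complex.I * toIocMod Real.two_pi_pos a θ) = Complex.exp (Complex.I * θ) := by
  rw [Complex.exp_eq_exp_iff_exists_int]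
  refine ⟨-toIocDiv Real.two_pi_pos a θ, ?_⟩
  rw [toIocMod]
  push_cast
  simp only [zsmul_eq_mul]
  ring

/-- The argument of a complex number in `(-2π, 0]`. -/
noncomputable def branchArg (z : ℂ) : ℝ :=
  toIocMod Real.two_pi_pos (-(2 * Real.pi)) z.arg

lemma branchArg_mem (z : ℂ) : branchArg z ∈ Set.Ioc (-(2 * Real.pi)) 0 := by
  simpa [branchArg] using toIocMod_mem_Ioc Real.two_pi_pos (-(2 * Real.pi)) z.arg

lemma exp_branchArg {z : ℂ} (hz : ‖z‖ = 1) : Complex.exp (Complex.I * branchArg z) = z := by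
  conv_rhs => rw [← Complex.norm_mul_exp_arg_mul_I z, hz, Complex.ofReal_one, one_mul]
  rw [branchArg, exp_toIocMod, mul_comm]

lemma exists_isBranch_exp_eq {U : Matrix ι ι ℂ} (hU : U ∈ unitary (Matrix ι ι ℂ)) :
    ∃ A, IsBranch A ∧ exp (Complex.I • A) = U := by
  have hN : IsStarNormal U := ⟨by
    rw [Commute, SemiconjBy, Unitary.star_mul_self_of_mem hU, Unitary.mul_star_self_of_mem hU]⟩
  have hfin : (spectrum ℂ U).Finite := U.finite_spectrum
  -- `branchArg` jumps at `1`, but every function is continuous on a finite spectrum.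
  have hcont : ∀ f : ℂ → ℂ, ContinuousOn f (spectrum ℂ U) := fun f => hfin.continuousOn f
  have hnorm : ∀ z ∈ spectrum ℂ U, ‖z‖ = 1 := fun z hz => by
    simpa using spectrum.subset_circle_of_unitary hU hz
  refine ⟨cfc (fun z => (branchArg z : ℂ)) U, ⟨?_, ?_⟩, ?_⟩
  · change star _ = _
    rw [← cfc_star]
    simp
  · intro r hr
    have h1 := spectrum.algebraMap_mem ℂ hr
    rw [cfc_map_spectrum (fun z => (branchArg z : ℂ)) U hN (hcont _)] at h1
    obtain ⟨z, -, hz⟩ := h1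
    have : branchArg z = r := Complex.ofReal_injective hz
    exact this ▸ branchArg_mem z
  · rw [← cfc_smul _ _ _ (hcont _), ← CFC.exp_eq_normedSpace_exp (𝕜 := ℂ) (by cfc_tac),
      ← cfc_comp' _ _ _ (by fun_prop) (hcont _)]
    conv_rhs => rw [← cfc_id' ℂ U]
    refine cfc_congr fun z hz => ?_
    simp only [smul_eq_mul]
    rw [← Complex.exp_eq_exp_ℂ]
    exact exp_branchArg (hnorm z hz)

lemma exp_neg_I_mul_smul_mem {U : Matrix ι ι ℂ} (hU : U ∈ unitary (Matrix ι ι ℂ)) (b : ℝ) :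
    Complex.exp (-(Complex.I * b)) • U ∈ unitary (Matrix ι ι ℂ) := by
  have h : Complex.exp (-(Complex.I * b)) ∈ unitary ℂ := by
    rw [Unitary.mem_iff]
    simp [← Complex.exp_conj, ← Complex.exp_add]
  exact Unitary.smul_mem_of_mem h hU

lemma exp_neg_I_add (a b : ℝ) : Complex.exp (-(Complex.I * (a + b : ℝ))) =
    Complex.exp (-(Complex.I * a)) * Complex.exp (-(Complex.I * b)) := by
  rw [← Complex.exp_add]
  push_cast
  ring_nf

lemma re_trace_iterate {A H : Matrix ι ι ℂ} (hA : IsBranch A) (hH : H.IsHermitian) {b : ℝ}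
    (hb : ‖H‖ ≤ b) (hsmall : Fintype.card ι * (2 * b) < 2 * Real.pi) (N : ℕ) :
    ∀ B : Matrix ι ι ℂ, IsBranch B →
      exp (Complex.I • B) = Complex.exp (-(Complex.I * (N * b : ℝ))) •
        (exp (Complex.I • A) * exp (Complex.I • H) ^ N) →
      A.trace.re + N * (H.trace.re - Fintype.card ι * b) ≤ B.trace.re := by
  induction N with
  | zero =>
    intro B hB h
    -- With no factors left, `A` and `B` are two logarithms of one unitary, compared by a trivial
    -- step.
    have := re_trace_step hA hB (H := 0) (by simp) (b := 0) (by simp) (by simp [Real.pi_pos])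
      (by simpa using h)
    simpa using this
  | succ N ih =>
    intro B hB h
    have hUN : exp (Complex.I • A) * exp (Complex.I • H) ^ N ∈ unitary (Matrix ι ι ℂ) :=
      mul_mem (exp_I_smul_mem_unitary hA.1) (pow_mem (exp_I_smul_mem_unitary hH) N)
    obtain ⟨C, hC, hCe⟩ := exists_isBranch_exp_eq (exp_neg_I_mul_smul_mem hUN (N * b))
    have h1 := ih C hC hCe
    have h2 := re_trace_step hC hB hH hb hsmall (by
      rw [h, hCe, smul_mul_assoc, smul_smul, mul_assoc, ← pow_succ, ← exp_neg_I_add]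
      congr 4
      push_cast; ring)
    push_cast
    linarith

/-- The smallness condition of `re_trace_step` is removed by cutting `H` into `N` equal pieces: both
sides of the bound are additive over the pieces. -/
lemma re_trace_mul_exp {A B H : Matrix ι ι ℂ} (hA : IsBranch A) (hB : IsBranch B)
    (hH : H.IsHermitian) {b : ℝ} (hb : ‖H‖ ≤ b)
    (h : exp (Complex.I • B) = Complex.exp (-(Complex.I * b)) •
      (exp (Complex.I • A) * exp (Complex.I • H))) :
    A.trace.re + (H.trace.re - Fintype.card ι * b) ≤ B.trace.re := by
  obtain ⟨N, hN⟩ := exists_nat_gt (Fintype.card ι * (2 * b) / (2 * Real.pi))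
  have hb0 : 0 ≤ b := (norm_nonneg _).trans hb
  have hNpos : (0 : ℝ) < N := lt_of_le_of_lt (by positivity) hN
  have hH' : ((N : ℝ)⁻¹ • H).IsHermitian := by
    rw [Matrix.IsHermitian, conjTranspose_smul, hH.eq]; simp
  have hmul : (N : ℝ) • (N : ℝ)⁻¹ • H = H := by rw [smul_smul, mul_inv_cancel₀ hNpos.ne', one_smul]
  have key := re_trace_iterate hA hH' (b := b / N) (by
      rw [norm_smul, norm_inv, Real.norm_natCast, div_eq_inv_mul]
      exact mul_le_mul_of_nonneg_left hb (by positivity)) (by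
      rw [div_lt_iff₀ (by positivity)] at hN
      rw [← mul_div_assoc, ← mul_div_assoc, div_lt_iff₀ hNpos]
      linarith) N B hB (by
      rw [mul_div_cancel₀ _ hNpos.ne', h, ← Matrix.exp_nsmul, smul_comm, ← Nat.cast_smul_eq_nsmul ℝ,
        hmul])
  have htr : ((N : ℝ)⁻¹ • H).trace.re = (N : ℝ)⁻¹ * H.trace.re := by
    rw [trace_smul, Complex.smul_re, smul_eq_mul]
  rw [htr] at key
  have : (N : ℝ) * ((N : ℝ)⁻¹ * H.trace.re - Fintype.card ι * (b / N)) =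
      H.trace.re - Fintype.card ι * b := by
    field_simp
  linarith

/-- If `exp (i B)` is a product of exponentials rotated clockwise by the length of the product,
where `B` has spectrum in `(-2π, 0]`, then `tr B` bounds the trace of the exponents. -/
lemma re_trace_list_prod (l : List (Matrix ι ι ℂ × ℝ))
    (hl : ∀ p ∈ l, p.1.IsHermitian ∧ ‖p.1‖ ≤ p.2) :
    ∀ A B : Matrix ι ι ℂ, IsBranch A → IsBranch B →
      exp (Complex.I • B) = Complex.exp (-(Complex.I * ((l.map Prod.snd).sum : ℝ))) •
        (exp (Complex.I • A) * (l.map fun p => exp (Complex.I • p.1)).prod) →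
      A.trace.re + ((l.map fun p => p.1.trace.re).sum - Fintype.card ι * (l.map Prod.snd).sum) ≤
        B.trace.re := by
  induction l with
  | nil =>
    intro A B hA hB h
    have := re_trace_mul_exp hA hB (H := 0) (by simp) (b := 0) (by simp) (by simpa using h)
    simpa using this
  | cons p l ih =>
    intro A B hA hB h
    obtain ⟨hp, hpn⟩ := hl p (by simp)
    have hU : exp (Complex.I • A) * exp (Complex.I • p.1) ∈ unitary (Matrix ι ι ℂ) :=
      mul_mem (exp_I_smul_mem_unitary hA.1) (exp_I_smul_mem_unitary hp)
    obtain ⟨C, hC, hCe⟩ := exists_isBranch_exp_eq (exp_neg_I_mul_smul_mem hU p.2)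
    have h1 := re_trace_mul_exp hA hC hp hpn hCe
    have h2 := ih (fun q hq => hl q (by simp [hq])) C B hC hB (by
      rw [h, hCe, smul_mul_assoc, smul_smul, List.map_cons, List.map_cons, List.sum_cons,
        List.prod_cons, mul_assoc, ← exp_neg_I_add, add_comm])
    simp only [List.map_cons, List.sum_cons]
    linarith

end Logarithm

/-! ### Two-sided trace bounds for diagonal products. -/

section Diagonal

variable {ι : Type*} [Fintype ι] [DecidableEq ι]

lemma isHermitian_diagonal_ofReal {ι : Type*} [DecidableEq ι] (d : ι → ℝ) :
    (diagonal fun i => (d i : ℂ)).IsHermitian := by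
  rw [Matrix.IsHermitian, diagonal_conjTranspose]
  congr 1
  funext i
  simp

lemma isBranch_diagonal {d : ι → ℝ} (hd : ∀ i, d i ∈ Set.Ioc (-(2 * Real.pi)) 0) :
    IsBranch (diagonal fun i => (d i : ℂ)) := by
  refine ⟨isHermitian_diagonal_ofReal d, fun r hr => ?_⟩
  have h1 := spectrum.algebraMap_mem ℂ hr
  rw [spectrum_diagonal] at h1
  obtain ⟨i, hi⟩ := h1
  have : d i = r := Complex.ofReal_injective hi
  exact this ▸ hd i

lemma exp_I_smul_diagonal (d : ι → ℝ) :
    exp (Complex.I • diagonal fun i => (d i : ℂ)) =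
      diagonal fun i => Complex.exp (Complex.I * d i) := by
  rw [← diagonal_smul, Matrix.exp_diagonal]
  congr 1
  funext i
  rw [Pi.coe_exp, Complex.exp_eq_exp_ℂ]
  rfl

lemma isBranch_zero : IsBranch (0 : Matrix ι ι ℂ) := by
  have := isBranch_diagonal (ι := ι) (d := fun _ => 0) fun i => ⟨by simp [Real.pi_pos], le_rfl⟩
  simpa using this

/-- For a diagonal product of exponentials of total length `ℓ`, the trace of the exponents is at
most the sum of the arguments of the diagonal entries taken in `(ℓ - 2π, ℓ]`. -/
lemma sum_re_trace_le (l : List (Matrix ι ι ℂ × ℝ))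
    (hl : ∀ p ∈ l, p.1.IsHermitian ∧ ‖p.1‖ ≤ p.2) (f : ι → ℝ)
    (hf : ∀ i, f i ∈ Set.Ioc ((l.map Prod.snd).sum - 2 * Real.pi) (l.map Prod.snd).sum)
    (h : (l.map fun p => exp (Complex.I • p.1)).prod =
      diagonal fun i => Complex.exp (Complex.I * f i)) :
    (l.map fun p => p.1.trace.re).sum ≤ ∑ i, f i := by
  -- Rotating clockwise by `ℓ` moves the window `(ℓ - 2π, ℓ]` onto `(-2π, 0]`; the term `card ι * ℓ`
  -- then cancels on both sides.
  have key := re_trace_list_prod l hl 0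
    (diagonal fun i => ((f i - (l.map Prod.snd).sum : ℝ) : ℂ)) isBranch_zero
    (isBranch_diagonal fun i => ⟨by linarith [(hf i).1], by linarith [(hf i).2]⟩) (by
      rw [exp_I_smul_diagonal, h, smul_zero, exp_zero, one_mul, ← diagonal_smul]
      congr 1
      funext i
      rw [Pi.smul_apply, smul_eq_mul, ← Complex.exp_add]
      congr 1
      push_cast; ring)
  rw [trace_diagonal, Complex.re_sum] at key
  simp only [Complex.ofReal_re, Finset.sum_sub_distrib, trace_zero, Complex.zero_re,
    Finset.sum_const, Finset.card_univ, nsmul_eq_mul] at key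
  linarith

/-- This is `sum_re_trace_le` for the inverse product: reversed order, negated exponents, same
length. -/
lemma le_sum_re_trace (l : List (Matrix ι ι ℂ × ℝ))
    (hl : ∀ p ∈ l, p.1.IsHermitian ∧ ‖p.1‖ ≤ p.2) (g : ι → ℝ)
    (hg : ∀ i, g i ∈ Set.Ico (-(l.map Prod.snd).sum) (-(l.map Prod.snd).sum + 2 * Real.pi))
    (h : (l.map fun p => exp (Complex.I • p.1)).prod =
      diagonal fun i => Complex.exp (Complex.I * g i)) :
    ∑ i, g i ≤ (l.map fun p => p.1.trace.re).sum := by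
  let l' : List (Matrix ι ι ℂ × ℝ) := (l.map fun p => (-p.1, p.2)).reverse
  have hsnd : (l'.map Prod.snd).sum = (l.map Prod.snd).sum := by
    simp [l', List.sum_reverse, Function.comp_def]
  have htr : (l'.map fun p => p.1.trace.re).sum = -(l.map fun p => p.1.trace.re).sum := by
    simp only [l', List.map_reverse, List.sum_reverse, List.map_map]
    clear hl hg h hsnd
    induction l with
    | nil => simp
    | cons p l ih => simp_all [add_comm]
  have hprod : (l'.map fun p => exp (Complex.I • p.1)).prod =
      star (l.map fun p => exp (Complex.I • p.1)).prod := by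
    simp only [l', List.map_reverse, List.map_map]
    clear hg h hsnd htr
    induction l with
    | nil => simp
    | cons p l ih =>
      have hp : exp (Complex.I • -p.1) = star (exp (Complex.I • p.1)) := by
        rw [star_exp, star_smul, show star p.1 = p.1 from (hl p (by simp)).1]
        simp
      simp only [List.map_cons, List.reverse_cons, List.prod_append, List.prod_cons, List.prod_nil,
        mul_one, star_mul, Function.comp_apply, hp, ih fun q hq => hl q (by simp [hq])]
  have key := sum_re_trace_le l' (by
      intro p hp
      simp only [l', List.mem_reverse, List.mem_map] at hp
      obtain ⟨q, hq, rfl⟩ := hp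
      exact ⟨(hl q hq).1.neg, by simpa using (hl q hq).2⟩) (fun i => -g i)
    (fun i => by rw [hsnd]; exact ⟨by linarith [(hg i).2], by linarith [(hg i).1]⟩) (by
      rw [hprod, h, star_eq_conjTranspose, diagonal_conjTranspose]
      congr 1
      funext i
      rw [Pi.star_apply, Complex.star_def, ← Complex.exp_conj]
      simp)
  rw [htr, Finset.sum_neg_distrib] at key
  linarith

end Diagonal

/-! ### Point evaluations as matrix representations. -/

section Representation

/-- Apply a representation `B → M_ι(ℂ)` to the entries of a matrix over `B`. -/
def flatten (m : ℕ) {ι : Type} [Fintype ι] [DecidableEq ι] {B : Type} [CStarAlgebra B]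
    (e : B →⋆ₐ[ℂ] Matrix ι ι ℂ) :
    CStarMatrix (Fin m) (Fin m) B →⋆ₐ[ℂ] Matrix (Fin m × ι) (Fin m × ι) ℂ where
  toFun M := Matrix.of fun a b => e (M a.1 b.1) a.2 b.2
  map_one' := by
    ext a b
    by_cases h : a.1 = b.1 <;> simp [CStarMatrix.one_apply, Matrix.one_apply, h, Prod.ext_iff]
  map_mul' M N := by
    ext a b
    simp [CStarMatrix.mul_apply, Matrix.mul_apply, Matrix.sum_apply, Fintype.sum_prod_type]
  map_zero' := by
    ext a b
    simp
  map_add' M N := by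
    ext a b
    simp
  commutes' c := by
    ext a b
    by_cases h : a.1 = b.1
    · simp [CStarMatrix.algebraMap_apply, h, Matrix.algebraMap_matrix_apply, Prod.ext_iff,
        AlgHomClass.commutes e c]
    · simp [CStarMatrix.algebraMap_apply, h, Matrix.algebraMap_matrix_apply, Prod.ext_iff]
  map_star' M := by
    ext a b
    simp [CStarMatrix.star_apply, map_star e, Matrix.star_apply]

/-- Evaluation at a point, as a representation `M₁₀(C[0,1]) → M₁₀(ℂ)`. -/
noncomputable def evalMatrix (t : I) :
    CStarMatrix (Fin 10) (Fin 10) C(I, ℂ) →⋆ₐ[ℂ] Matrix (Fin 10) (Fin 10) ℂ where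
  toFun M := Matrix.of fun a b => M a b t
  map_one' := by
    ext a b
    by_cases h : a = b <;> simp [CStarMatrix.one_apply, Matrix.one_apply, h]
  map_mul' M N := by
    ext a b
    simp [CStarMatrix.mul_apply, Matrix.mul_apply]
  map_zero' := rfl
  map_add' _ _ := rfl
  commutes' c := by
    ext a b
    by_cases h : a = b <;>
      simp [CStarMatrix.algebraMap_apply, h, Matrix.algebraMap_matrix_apply]
  map_star' M := by
    ext a b
    simp [CStarMatrix.star_apply, Matrix.star_apply]

/-- The index set of the matrices that elements of `Alg k n` take as values. -/
def Idx (k : ℕ → ℕ) : ℕ → Type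
  | 0 => Fin 10
  | n + 1 => Fin (10 ^ k n) × Idx k n

instance instFintypeIdx (k : ℕ → ℕ) : (n : ℕ) → Fintype (Idx k n)
  | 0 => inferInstanceAs (Fintype (Fin 10))
  | n + 1 =>
    letI := instFintypeIdx k n
    inferInstanceAs (Fintype (Fin (10 ^ k n) × Idx k n))

instance instDecidableEqIdx (k : ℕ → ℕ) : (n : ℕ) → DecidableEq (Idx k n)
  | 0 => inferInstanceAs (DecidableEq (Fin 10))
  | n + 1 =>
    letI := instDecidableEqIdx k n
    inferInstanceAs (DecidableEq (Fin (10 ^ k n) × Idx k n))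

/-- Evaluation of the elements of `Alg k n` at `t ∈ [0,1]`. -/
noncomputable def rep (k : ℕ → ℕ) (t : I) : (n : ℕ) → (Alg k n →⋆ₐ[ℂ] Matrix (Idx k n) (Idx k n) ℂ)
  | 0 => evalMatrix t
  | n + 1 => flatten (10 ^ k n) (rep k t n)

lemma rep_evalAt (k : ℕ → ℕ) (s t : I) (n : ℕ) (f : Alg k n) :
    rep k t n (evalAt k s n f) = rep k s n f := by
  induction n with
  | zero => rfl
  | succ n ih =>
    ext a b
    change rep k t n (evalAt k s n ((f : CStarMatrix (Fin (10 ^ k n)) (Fin (10 ^ k n)) (Alg k n))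
      a.1 b.1)) a.2 b.2 = _
    rw [ih]
    rfl

lemma continuous_rep_apply (k : ℕ → ℕ) (n : ℕ) (f : Alg k n) (a b : Idx k n) :
    Continuous fun t => rep k t n f a b := by
  induction n with
  | zero =>
    exact ((f : CStarMatrix (Fin 10) (Fin 10) C(I, ℂ)) a b).continuous
  | succ n ih =>
    exact ih ((f : CStarMatrix (Fin (10 ^ k n)) (Fin (10 ^ k n)) (Alg k n)) a.1 b.1) a.2 b.2

lemma rep_connect (k : ℕ → ℕ) (x : ℕ → I) (t : I) (n : ℕ) (f : Alg k n) (a b : Idx k (n + 1)) :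
    rep k t (n + 1) (connect k x n f) a b = if a.1 = b.1 then
      (if (a.1 : ℕ) + 1 = 10 ^ k n then rep k (x n) n f else rep k t n f) a.2 b.2 else 0 := by
  change rep k t n (Matrix.diagonal (fun i : Fin (10 ^ k n) =>
    if (i : ℕ) + 1 = 10 ^ k n then evalAt k (x n) n f else f) a.1 b.1) a.2 b.2 = _
  rw [Matrix.diagonal_apply]
  split_ifs
  · rw [rep_evalAt]
  · rfl
  · rw [map_zero]; rfl

end Representation

/-! ### The unitary as a single exponential. -/

section ExponentialForm

lemma starAlgHom_exp {A B : Type*} [CStarAlgebra A] [CStarAlgebra B] (φ : A →⋆ₐ[ℂ] B) (f : A) :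
    φ (exp (Complex.I • f)) = exp (Complex.I • φ f) := by
  let _ : NormedAlgebra ℚ A := NormedAlgebra.restrictScalars ℚ ℂ A
  let _ : NormedAlgebra ℚ B := NormedAlgebra.restrictScalars ℚ ℂ B
  have hc : Continuous φ := AddMonoidHomClass.continuous_of_bound φ 1 fun f => by
    simpa using NonUnitalStarAlgHom.norm_apply_le φ f
  rw [NormedSpace.map_exp φ hc, map_smul]

/-- The function `t ↦ 2 π t c` in `C[0,1]`. -/
noncomputable def linFun (c : ℝ) : C(I, ℂ) where
  toFun t := ((2 * Real.pi * t * c : ℝ) : ℂ)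
  continuous_toFun := by fun_prop

/-- A self-adjoint logarithm of `uMat`. -/
noncomputable def logMat (k : ℕ → ℕ) (ε : ℝ) : Alg k 0 :=
  CStarMatrix.ofMatrix (Matrix.diagonal fun i : Fin 10 =>
    if i = 0 then linFun (-(9 / 10 - ε)) else linFun (1 / 10 - ε))

lemma rep_zero_logMat (k : ℕ → ℕ) (ε : ℝ) (t : I) :
    rep k t 0 (logMat k ε) = (Matrix.diagonal fun i : Fin 10 =>
      ((2 * Real.pi * t * (if i = 0 then -(9 / 10 - ε) else 1 / 10 - ε) : ℝ) : ℂ) :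
        Matrix (Fin 10) (Fin 10) ℂ) := by
  refine Matrix.ext fun (a b : Fin 10) => ?_
  change (Matrix.diagonal (fun i : Fin 10 =>
    if i = 0 then linFun (-(9 / 10 - ε)) else linFun (1 / 10 - ε)) a b : C(I, ℂ)) t =
    Matrix.diagonal (fun i : Fin 10 => ((2 * Real.pi * t * (if i = 0 then -(9 / 10 - ε) else 1 / 10 - ε) : ℝ) : ℂ)) a b
  by_cases h : a = b
  · subst h
    rw [Matrix.diagonal_apply_eq, Matrix.diagonal_apply_eq]
    split_ifs <;> rfl
  · rw [Matrix.diagonal_apply_ne _ h, Matrix.diagonal_apply_ne _ h]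
    rfl

lemma rep_zero_uMat (k : ℕ → ℕ) (ε : ℝ) (t : I) :
    rep k t 0 (uMat k ε) = (Matrix.diagonal fun i : Fin 10 =>
      Complex.exp (Complex.I * (2 * Real.pi * t *
        (if i = 0 then -(9 / 10 - ε) else 1 / 10 - ε) : ℝ)) : Matrix (Fin 10) (Fin 10) ℂ) := by
  refine Matrix.ext fun (a b : Fin 10) => ?_
  change (Matrix.diagonal (fun i : Fin 10 =>
    if i = 0 then expFun (-(9 / 10 - ε)) else expFun (1 / 10 - ε)) a b : C(I, ℂ)) t =
    Matrix.diagonal (fun i : Fin 10 => Complex.exp (Complex.I * (2 * Real.pi * t *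
      (if i = 0 then -(9 / 10 - ε) else 1 / 10 - ε) : ℝ))) a b
  by_cases h : a = b
  · subst h
    rw [Matrix.diagonal_apply_eq, Matrix.diagonal_apply_eq]
    split_ifs <;> simp only [expFun, ContinuousMap.coe_mk] <;> congr 1 <;> push_cast <;> ring
  · rw [Matrix.diagonal_apply_ne _ h, Matrix.diagonal_apply_ne _ h]
    rfl

lemma ext_rep_zero (k : ℕ → ℕ) {f g : Alg k 0} (h : ∀ t, rep k t 0 f = rep k t 0 g) : f = g := by
  refine CStarMatrix.ext fun a b => ContinuousMap.ext fun t => ?_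
  exact congrFun (congrFun (h t) a) b

lemma isSelfAdjoint_logMat (k : ℕ → ℕ) (ε : ℝ) : IsSelfAdjoint (logMat k ε) := by
  refine ext_rep_zero k fun t => ?_
  rw [map_star, rep_zero_logMat]
  exact isHermitian_diagonal_ofReal _

lemma exp_logMat (k : ℕ → ℕ) (ε : ℝ) : exp (Complex.I • logMat k ε) = uMat k ε := by
  refine ext_rep_zero k fun t => ?_
  rw [starAlgHom_exp, rep_zero_logMat, rep_zero_uMat]
  exact exp_I_smul_diagonal _

/-- This gives membership in the component of `1`, and also that the set defining `cel` is nonempty,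
without which its `sInf` would be the default value `0`. -/
lemma phiU_eq_expUnitary (k : ℕ → ℕ) (x : ℕ → I) (n : ℕ) (ε : ℝ) :
    phiU k x n ε = selfAdjoint.expUnitary
      ⟨phi k x n (logMat k ε), (isSelfAdjoint_logMat k ε).map (phi k x n)⟩ := by
  refine Subtype.ext ?_
  change phi k x n (uMat k ε) = exp (Complex.I • phi k x n (logMat k ε))
  rw [← starAlgHom_exp, exp_logMat]

end ExponentialForm

/-! ### Diagonal entries and the count of their weights. -/

section Coefficients

/-- The slopes of the arguments of the diagonal entries of `phiU`, divided by `2 π`. -/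
noncomputable def slope (k : ℕ → ℕ) (ε : ℝ) : (n : ℕ) → Idx k n → ℝ
  | 0 => fun i : Fin 10 => if i = 0 then -(9 / 10 - ε) else 1 / 10 - ε
  | n + 1 => fun a => if (a.1 : ℕ) + 1 = 10 ^ k n then 0 else slope k ε n a.2

/-- The arguments at `t = 0` of the diagonal entries of `phiU`, divided by `2 π`. -/
noncomputable def offset (k : ℕ → ℕ) (x : ℕ → I) (ε : ℝ) : (n : ℕ) → Idx k n → ℝ
  | 0, _ => 0
  | n + 1, a => if (a.1 : ℕ) + 1 = 10 ^ k n then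
      offset k x ε n a.2 + slope k ε n a.2 * x n else offset k x ε n a.2

/-- The weight `-1` on the entries that move clockwise, `0` on those that move counterclockwise, and
`1` on the constant ones. -/
def weight (k : ℕ → ℕ) : (n : ℕ) → Idx k n → ℤ
  | 0 => fun i : Fin 10 => if i = 0 then -1 else 0
  | n + 1 => fun a => if (a.1 : ℕ) + 1 = 10 ^ k n then 1 else weight k n a.2

lemma weight_cases (k : ℕ → ℕ) (x : ℕ → I) (ε : ℝ) (n : ℕ) (i : Idx k n) :
    (weight k n i = -1 ∧ offset k x ε n i = 0 ∧ slope k ε n i = -(9 / 10 - ε)) ∨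
    (weight k n i = 0 ∧ offset k x ε n i = 0 ∧ slope k ε n i = 1 / 10 - ε) ∨
    (weight k n i = 1 ∧ slope k ε n i = 0) := by
  induction n with
  | zero =>
    simp only [weight, offset, slope]
    split_ifs <;> simp
  | succ n ih =>
    simp only [weight, offset, slope]
    split_ifs
    · simp
    · exact ih i.2

lemma rep_phiU (k : ℕ → ℕ) (x : ℕ → I) (ε : ℝ) (n : ℕ) (t : I) :
    rep k t n (phiU k x n ε) = diagonal fun i => Complex.exp (Complex.I *
      (2 * Real.pi * (offset k x ε n i + slope k ε n i * t) : ℝ)) := by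
  induction n generalizing t with
  | zero =>
    refine (rep_zero_uMat k ε t).trans ?_
    change _ = (diagonal fun i : Fin 10 => _ : Matrix (Fin 10) (Fin 10) ℂ)
    congr 1
    funext i
    simp only [offset, slope]
    congr 3
    ring
  | succ n ih =>
    ext a b
    change rep k t (n + 1) (connect k x n (phiU k x n ε)) a b = _
    rw [rep_connect]
    by_cases h : a = b
    · subst h
      rw [if_pos rfl, diagonal_apply_eq]
      simp only [offset, slope]
      split_ifs
      · rw [ih, diagonal_apply_eq]
        simp
      · rw [ih, diagonal_apply_eq]
    · rw [diagonal_apply_ne _ h]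
      split_ifs with h1 h2
      · rw [ih, diagonal_apply_ne _ fun h3 => h (Prod.ext h1 h3)]
      · rw [ih, diagonal_apply_ne _ fun h3 => h (Prod.ext h1 h3)]
      · rfl

lemma card_Idx_succ (k : ℕ → ℕ) (n : ℕ) :
    Fintype.card (Idx k (n + 1)) = 10 ^ k n * Fintype.card (Idx k n) :=
  (Fintype.card_prod (Fin (10 ^ k n)) (Idx k n)).trans (by rw [Fintype.card_fin])

lemma card_Idx_pos (k : ℕ → ℕ) (n : ℕ) : 0 < Fintype.card (Idx k n) := by
  induction n with
  | zero => exact (Fintype.card_fin 10).symm ▸ Nat.zero_lt_succ _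
  | succ n ih => rw [card_Idx_succ]; positivity

lemma sum_weight_succ (k : ℕ → ℕ) (n : ℕ) :
    ∑ a, weight k (n + 1) a =
      (10 ^ k n - 1) * ∑ i, weight k n i + Fintype.card (Idx k n) := by
  obtain ⟨m, hm⟩ : ∃ m, 10 ^ k n = m + 1 := Nat.exists_eq_add_one.2 (by positivity)
  have h1 : ∑ a, weight k (n + 1) a = ∑ a : Fin (10 ^ k n), ∑ i : Idx k n,
      if (a : ℕ) + 1 = 10 ^ k n then 1 else weight k n i :=
    Fintype.sum_prod_type (fun a : Fin (10 ^ k n) × Idx k n =>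
      if (a.1 : ℕ) + 1 = 10 ^ k n then 1 else weight k n a.2)
  have h2 : ((10 : ℤ) ^ k n - 1) = m := by
    have : ((10 ^ k n : ℕ) : ℤ) = m + 1 := by rw [hm]; push_cast; rfl
    push_cast at this
    linarith
  rw [h1, h2, hm, Fin.sum_univ_castSucc]
  congr 1
  · rw [Finset.sum_congr rfl (g := fun _ => ∑ i, weight k n i) fun a _ =>
      Finset.sum_congr rfl fun i _ => if_neg (by simp [a.2.ne])]
    simp
  · simp

/-- New constant entries have weight `1` and add nothing to the left side, which is therefore
multiplied by `10 ^ k n - 1` at each stage. It starts at `10 - (-1) = 11`. -/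
lemma card_sub_sum_weight (k : ℕ → ℕ) (n : ℕ) :
    (Fintype.card (Idx k n) : ℝ) - (∑ i, weight k n i : ℤ) =
      11 / 10 * Fintype.card (Idx k n) *
        ∏ j ∈ Finset.range n, ((10 : ℝ) ^ k j - 1) / (10 : ℝ) ^ k j := by
  induction n with
  | zero =>
    have h1 : Fintype.card (Idx k 0) = 10 := Fintype.card_fin 10
    have h2 : ∑ i, weight k 0 i = -1 :=
      show ∑ i : Fin 10, (if i = 0 then (-1 : ℤ) else 0) = -1 by simp
    rw [h1, h2]
    norm_num
  | succ n ih =>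
    rw [Finset.prod_range_succ, sum_weight_succ, card_Idx_succ]
    have hpos : (0 : ℝ) < 10 ^ k n := by positivity
    have : (11 : ℝ) / 10 * ((10 ^ k n * Fintype.card (Idx k n) : ℕ) : ℝ) *
        ((∏ j ∈ Finset.range n, ((10 : ℝ) ^ k j - 1) / (10 : ℝ) ^ k j) *
          (((10 : ℝ) ^ k n - 1) / (10 : ℝ) ^ k n)) = ((10 : ℝ) ^ k n - 1) *
        (11 / 10 * Fintype.card (Idx k n) *
          ∏ j ∈ Finset.range n, ((10 : ℝ) ^ k j - 1) / (10 : ℝ) ^ k j) := by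
      push_cast
      field_simp
    rw [this, ← ih]
    push_cast
    ring

lemma le_prod_range_of_hasProd {a : ℕ → ℝ} {P : ℝ} (h0 : ∀ n, 0 ≤ a n) (h1 : ∀ n, a n ≤ 1)
    (hP : HasProd a P) (n : ℕ) : P ≤ ∏ j ∈ Finset.range n, a j := by
  have hanti : Antitone fun n => ∏ j ∈ Finset.range n, a j :=
    antitone_nat_of_succ_le fun n => by
      rw [Finset.prod_range_succ]
      exact mul_le_of_le_one_right (Finset.prod_nonneg fun j _ => h0 j) (h1 n)
  exact hanti.le_of_tendsto hP.tendsto_prod_nat n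

/-- The constant `11 / 12` enters through `11 / 10 * (11 / 12) = 121 / 120 > 1`, which makes the
left side of `card_sub_sum_weight` exceed the cardinality. -/
lemma sum_weight_neg (k : ℕ → ℕ) {P : ℝ}
    (hP : HasProd (fun n : ℕ => ((10 : ℝ) ^ k n - 1) / (10 : ℝ) ^ k n) P)
    (hP_gt : 11 / 12 < P) (n : ℕ) : ∑ i, weight k n i < 0 := by
  have h1 : ∀ n, (1 : ℝ) ≤ 10 ^ k n := fun n => one_le_pow₀ (by norm_num)
  have hle := le_prod_range_of_hasProd
    (fun n => div_nonneg (by linarith [h1 n]) (by linarith [h1 n]))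
    (fun n => div_le_one_of_le₀ (by linarith) (by linarith [h1 n])) hP n
  have hc : (0 : ℝ) < Fintype.card (Idx k n) := by exact_mod_cast card_Idx_pos k n
  have hmul := mul_lt_mul_of_pos_left (hP_gt.trans_le hle)
    (show 0 < 11 / 10 * (Fintype.card (Idx k n) : ℝ) by positivity)
  rw [← card_sub_sum_weight] at hmul
  have : ((∑ i, weight k n i : ℤ) : ℝ) < 0 := by linarith
  exact_mod_cast this

end Coefficients

/-! ### Comparison of the endpoints and the lower bound. -/

section LowerBound

/-- A continuous function on `[0,1]` with values in `2πℤ` is constant. -/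
lemma eq_of_continuous_of_two_pi_int {D : I → ℝ} (hD : Continuous D)
    (h : ∀ t, ∃ m : ℤ, D t = m * (2 * Real.pi)) (s t : I) : D s = D t := by
  have hdisc : DiscreteTopology (Set.range ((↑) : ℤ → ℝ)) :=
    Int.isClosedEmbedding_coe_real.isEmbedding.toHomeomorph.symm.isEmbedding.discreteTopology
  have hmaps : Set.MapsTo (fun t => D t / (2 * Real.pi)) Set.univ
      (Set.range ((↑) : ℤ → ℝ)) := fun t _ => by
    obtain ⟨m, hm⟩ := h t
    exact ⟨m, by simp only [hm]; field_simp⟩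
  have := isPreconnected_univ.constant_of_mapsTo ⟨hdisc⟩ (hD.div_const _).continuousOn hmaps
    (Set.mem_univ s) (Set.mem_univ t)
  exact (div_left_inj' Real.two_pi_pos.ne').1 this

/-- The exponents of a factorization evaluated at `t`, with their norms. -/
noncomputable def evalFactors (k : ℕ → ℕ) (n : ℕ) (t : I) (l : List (selfAdjoint (Alg k n))) :
    List (Matrix (Idx k n) (Idx k n) ℂ × ℝ) :=
  l.map fun h : selfAdjoint (Alg k n) => (rep k t n (h : Alg k n), ‖h‖)

variable {k : ℕ → ℕ} {n : ℕ}

lemma evalFactors_spec (t : I) (l : List (selfAdjoint (Alg k n))) :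
    ∀ p ∈ evalFactors k n t l, p.1.IsHermitian ∧ ‖p.1‖ ≤ p.2 := by
  intro p hp
  obtain ⟨h, -, rfl⟩ := List.mem_map.1 hp
  exact ⟨h.2.map (rep k t n), NonUnitalStarAlgHom.norm_apply_le (rep k t n) (h : Alg k n)⟩

lemma evalFactors_snd (t : I) (l : List (selfAdjoint (Alg k n))) :
    (evalFactors k n t l).map Prod.snd = l.map fun h => ‖h‖ := by
  simp [evalFactors, Function.comp_def]

lemma evalFactors_prod (t : I) (l : List (selfAdjoint (Alg k n))) :
    ((evalFactors k n t l).map fun p => exp (Complex.I • p.1)).prod =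
      rep k t n ((l.map selfAdjoint.expUnitary).prod : unitary (Alg k n)) := by
  induction l with
  | nil => simp [evalFactors]
  | cons h l ih =>
    simp only [evalFactors, List.map_cons, List.prod_cons] at ih ⊢
    rw [ih, Submonoid.coe_mul, map_mul, selfAdjoint.expUnitary_coe, starAlgHom_exp]

/-- The sum of the traces of the exponents of a factorization, evaluated at `t`. -/
noncomputable def traceSum (k : ℕ → ℕ) (n : ℕ) (l : List (selfAdjoint (Alg k n))) (t : I) : ℝ :=
  ((evalFactors k n t l).map fun p => p.1.trace.re).sum

lemma continuous_traceSum (l : List (selfAdjoint (Alg k n))) : Continuous (traceSum k n l) := by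
  induction l with
  | nil => exact continuous_const
  | cons h l ih =>
    have : traceSum k n (h :: l) =
        fun t => (rep k t n (h : Alg k n)).trace.re + traceSum k n l t := by
      funext t
      simp [traceSum, evalFactors]
    rw [this]
    refine Continuous.add (Complex.continuous_re.comp ?_) ih
    exact continuous_finsetSum _ fun i _ => continuous_rep_apply k n (h : Alg k n) i i

lemma det_rep_prod (t : I) (l : List (selfAdjoint (Alg k n))) :
    (rep k t n ((l.map selfAdjoint.expUnitary).prod : unitary (Alg k n))).det =
      Complex.exp (Complex.I * traceSum k n l t) := by
  rw [← evalFactors_prod, traceSum]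
  have hspec := evalFactors_spec t l
  generalize evalFactors k n t l = L at hspec
  induction L with
  | nil => simp
  | cons p L ih =>
    have hp := (hspec p (by simp)).1
    rw [List.map_cons, List.map_cons, List.prod_cons, List.sum_cons, det_mul, det_exp_I_smul hp,
      ih fun q hq => hspec q (by simp [hq]), ← Complex.exp_add, trace_eq_ofReal_re hp]
    congr 1
    push_cast [Complex.ofReal_re]; ring

variable {x : ℕ → I} {ε : ℝ}

/-- The trace sum minus the sum of the linear arguments is continuous and, by determinants, takes
values in `2πℤ`; hence it is constant. -/
lemma traceSum_one_sub_zero {l : List (selfAdjoint (Alg k n))}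
    (hl : phiU k x n ε = (l.map selfAdjoint.expUnitary).prod) :
    traceSum k n l 1 - traceSum k n l 0 = 2 * Real.pi * ∑ i, slope k ε n i := by
  let D : I → ℝ := fun t =>
    traceSum k n l t - ∑ i, 2 * Real.pi * (offset k x ε n i + slope k ε n i * t)
  have hD : Continuous D := by
    have := continuous_traceSum l
    fun_prop
  have hint : ∀ t, ∃ m : ℤ, D t = m * (2 * Real.pi) := by
    intro t
    have h := det_rep_prod t l
    rw [← hl, rep_phiU, det_diagonal, ← Complex.exp_sum, ← Finset.mul_sum, ← Complex.ofReal_sum,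
      eq_comm, Complex.exp_eq_exp_iff_exists_int] at h
    obtain ⟨m, hm⟩ := h
    refine ⟨m, ?_⟩
    have := congrArg Complex.im hm
    simp only [Complex.add_im, Complex.I_mul_im, Complex.ofReal_re] at this
    simp only [D, this]
    simp
  have h01 := eq_of_continuous_of_two_pi_int hD hint 1 0
  simp only [D, Set.Icc.coe_one, Set.Icc.coe_zero, mul_one, mul_zero, mul_add,
    Finset.sum_add_distrib, Finset.sum_const_zero] at h01
  rw [Finset.mul_sum]
  linarith

lemma exp_toIcoMod (a θ : ℝ) :
    Complex.exp (Complex.I * toIcoMod Real.two_pi_pos a θ) = Complex.exp (Complex.I * θ) := by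
  rw [Complex.exp_eq_exp_iff_exists_int]
  refine ⟨-toIcoDiv Real.two_pi_pos a θ, ?_⟩
  rw [toIcoMod]
  push_cast
  simp only [zsmul_eq_mul]
  ring

/-- The difference is a multiple of `2π` and at most `ℓ - (-ℓ) < 4π`. -/
lemma toIocMod_sub_toIcoMod_le {ℓ θ : ℝ} (hℓ : ℓ < 2 * Real.pi) :
    toIocMod Real.two_pi_pos (ℓ - 2 * Real.pi) θ - toIcoMod Real.two_pi_pos (-ℓ) θ ≤
      2 * Real.pi := by
  have h1 := (toIocMod_mem_Ioc Real.two_pi_pos (ℓ - 2 * Real.pi) θ).2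
  have h2 := (toIcoMod_mem_Ico Real.two_pi_pos (-ℓ) θ).1
  have h3 : toIocMod Real.two_pi_pos (ℓ - 2 * Real.pi) θ - toIcoMod Real.two_pi_pos (-ℓ) θ =
      (toIcoDiv Real.two_pi_pos (-ℓ) θ - toIocDiv Real.two_pi_pos (ℓ - 2 * Real.pi) θ : ℤ) *
        (2 * Real.pi) := by
    rw [toIocMod, toIcoMod]
    push_cast
    simp only [zsmul_eq_mul]
    ring
  generalize toIcoDiv Real.two_pi_pos (-ℓ) θ - toIocDiv Real.two_pi_pos (ℓ - 2 * Real.pi) θ = m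
    at h3
  have hm : (m : ℝ) < 2 := by
    by_contra! hcon
    have := mul_le_mul_of_nonneg_right hcon Real.two_pi_pos.le
    linarith
  have hm1 : (m : ℝ) ≤ 1 := by
    have : m < 2 := by exact_mod_cast hm
    exact_mod_cast (show m ≤ 1 by omega)
  have := mul_le_mul_of_nonneg_right hm1 Real.two_pi_pos.le
  linarith

lemma slope_add_toIocMod_sub_toIcoMod_le (hε : 0 < ε) (hε' : ε < 1 / 100) {ℓ : ℝ} (hℓ0 : 0 ≤ ℓ)
    (hℓ : ℓ < 2 * Real.pi * (9 / 10 - ε)) (i : Idx k n) :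
    2 * Real.pi * slope k ε n i +
        toIocMod Real.two_pi_pos (ℓ - 2 * Real.pi) (2 * Real.pi * offset k x ε n i) -
        toIcoMod Real.two_pi_pos (-ℓ) (2 * Real.pi * (offset k x ε n i + slope k ε n i)) ≤
      2 * Real.pi * weight k n i := by
  have hπ := Real.two_pi_pos
  have hℓ1 : ℓ < 2 * Real.pi := hℓ.trans (mul_lt_of_lt_one_right hπ (by linarith))
  have hπε : 0 < 2 * Real.pi * ε := by positivity
  have hπε' : 2 * Real.pi * ε < 2 * Real.pi * (1 / 100) := by gcongr
  have hzero : toIocMod Real.two_pi_pos (ℓ - 2 * Real.pi) 0 = 0 :=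
    (toIocMod_eq_iff _).2 ⟨⟨by linarith, by linarith⟩, 0, by simp⟩
  rcases weight_cases k x ε n i with ⟨hw, hp, hq⟩ | ⟨hw, hp, hq⟩ | ⟨hw, hq⟩
  -- Since `ℓ < 2π(9/10 - ε)`, the endpoint `-2π(9/10 - ε)` lies below the window `[-ℓ, 2π - ℓ)`,
  -- and its representative there is one turn higher.
  · have h2 : toIcoMod Real.two_pi_pos (-ℓ) (2 * Real.pi * (0 + -(9 / 10 - ε))) =
        2 * Real.pi * (1 / 10 + ε) :=
      (toIcoMod_eq_iff _).2 ⟨⟨by linarith, by linarith⟩, -1, by simp; ring⟩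
    rw [hw, hp, hq, mul_zero, hzero, h2]
    push_cast
    linarith
  -- Here the endpoint is already in the window, as `1/10 - ε < 1/10 + ε < 1 - ℓ / (2π)`.
  · have h2 : toIcoMod Real.two_pi_pos (-ℓ) (2 * Real.pi * (0 + (1 / 10 - ε))) =
        2 * Real.pi * (1 / 10 - ε) :=
      (toIcoMod_eq_iff _).2 ⟨⟨by linarith, by linarith⟩, 0, by simp⟩
    rw [hw, hp, hq, mul_zero, hzero, h2]
    push_cast
    linarith
  · have := toIocMod_sub_toIcoMod_le (θ := 2 * Real.pi * offset k x ε n i) hℓ1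
    rw [hw, hq, add_zero]
    push_cast
    linarith

/-- Every factorization of `phiU` into exponentials has length at least `2π(9/10 - ε)`. -/
lemma le_sum_norm_of_factorization {P : ℝ}
    (hP : HasProd (fun n : ℕ => ((10 : ℝ) ^ k n - 1) / (10 : ℝ) ^ k n) P)
    (hP_gt : 11 / 12 < P) (hε : 0 < ε) (hε' : ε < 1 / 100) {l : List (selfAdjoint (Alg k n))}
    (hl : phiU k x n ε = (l.map selfAdjoint.expUnitary).prod) :
    2 * Real.pi * (9 / 10 - ε) ≤ (l.map fun h => ‖h‖).sum := by
  by_contra! hℓ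
  set ℓ := (l.map fun h => ‖h‖).sum with hℓdef
  have hℓ0 : 0 ≤ ℓ := List.sum_nonneg fun r hr => by
    obtain ⟨h, -, rfl⟩ := List.mem_map.1 hr
    exact norm_nonneg h
  have h0 : traceSum k n l 0 ≤
      ∑ i, toIocMod Real.two_pi_pos (ℓ - 2 * Real.pi) (2 * Real.pi * offset k x ε n i) := by
    refine sum_re_trace_le _ (evalFactors_spec 0 l) _ (fun i => ?_) ?_
    · rw [evalFactors_snd, ← hℓdef]
      simpa using toIocMod_mem_Ioc Real.two_pi_pos (ℓ - 2 * Real.pi)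
        (2 * Real.pi * offset k x ε n i)
    · rw [evalFactors_prod, ← hl, rep_phiU]
      simp only [exp_toIocMod, Set.Icc.coe_zero, mul_zero, add_zero]
  have h1 : ∑ i, toIcoMod Real.two_pi_pos (-ℓ)
      (2 * Real.pi * (offset k x ε n i + slope k ε n i)) ≤ traceSum k n l 1 := by
    refine le_sum_re_trace _ (evalFactors_spec 1 l) _ (fun i => ?_) ?_
    · rw [evalFactors_snd, ← hℓdef]
      exact toIcoMod_mem_Ico Real.two_pi_pos (-ℓ) _
    · rw [evalFactors_prod, ← hl, rep_phiU]
      simp only [exp_toIcoMod, Set.Icc.coe_one, mul_one]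
  have hdiff := traceSum_one_sub_zero hl
  have hsum := Finset.sum_le_sum fun i (_ : i ∈ Finset.univ) =>
    slope_add_toIocMod_sub_toIcoMod_le (k := k) (n := n) (x := x) hε hε' hℓ0 hℓ i
  rw [Finset.sum_sub_distrib, Finset.sum_add_distrib, ← Finset.mul_sum, ← Finset.mul_sum,
    ← Int.cast_sum] at hsum
  have hw : ((∑ i, weight k n i : ℤ) : ℝ) < 0 := by exact_mod_cast sum_weight_neg k hP hP_gt n
  have := mul_neg_of_pos_of_neg Real.two_pi_pos hw
  linarith

end LowerBound

end Goodearl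

theorem theorem3p14 (k : ℕ → ℕ) (x : ℕ → unitInterval)
    (hx_inj : Function.Injective x) (hx_dense : DenseRange x)
    (P : ℝ) (hP : HasProd (fun n : ℕ => ((10 : ℝ) ^ k n - 1) / (10 : ℝ) ^ k n) P)
    (hP_gt : 11 / 12 < P)
    (ε : ℝ) (hε_pos : 0 < ε) (hε_lt : ε < 1 / 100) (n : ℕ) :
    Goodearl.phiU k x n ε ∈
        connectedComponent (1 : unitary (Goodearl.Alg k n)) ∧
      2 * Real.pi * (9 / 10 - ε) - 5 * ε ≤
        Goodearl.cel (Goodearl.phiU k x n ε) := by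
  have hexp := Goodearl.phiU_eq_expUnitary k x n ε
  constructor
  · rw [hexp]
    exact pathComponent_subset_component _ (selfAdjoint.joined_one_expUnitary _)
  · refine le_csInf ⟨_, [_], by simpa using hexp, rfl⟩ ?_
    rintro r ⟨l, hl, rfl⟩
    linarith [Goodearl.le_sum_norm_of_factorization hP hP_gt hε_pos hε_lt hl]
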